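/- Let $n\ge 0$, $m_1\ge 1$, $m_2\ge 0$ be integers and let $L_j = A_{j,0}+\sum_{i=1}^n X_iA_{j,i}$ ($j=1,2$) be linear pencils of sizes $m_1$ and $m_2$ in the same commuting variables $X_1,\dots,X_n$; that is, each $A_{j,i}$ is a real symmetric $m_j\times m_j$ matrix. Write $\succeq 0$ for "symmetric positive semidefinite". Let $$S_{L_j}=\{x\in\mathbb R^n : A_{j,0}+\textstyle\sum_i x_iA_{j,i}\succeq 0\}$$ be the spectrahedron of $L_j$, and let $$\mathfrak S_{L_j}=\bigcup_{d\ge 1}\Big\{(Z_1,\dots,Z_n) : Z_i\in\mathbb R^{d\times d}\text{ symmetric},\ I_d\otimes A_{j,0}+\textstyle\sum_i Z_i\otimes A_{j,i}\succeq 0\Big\}$$ be its matricial spectrahedron, where $\otimes$ is the Kronecker product. Suppose that $S_{L_1}$ is non-empty and bounded, and that the real linear span of $A_{1,0},A_{1,1},\dots,A_{1,n}$ contains a positive definite matrix. Then the following are equivalent: (i) $\mathfrak S_{L_1}\subseteq\mathfrak S_{L_2}$; (ii) there exist an integer $\mu\ge 1$ and a real matrix $V\in\mathbb R^{\mu m_1\times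 m_2}$ such that $$L_2=V^*\,(I_\mu\otimes L_1)\,V$$ as an identity of matrices over the polynomial ring $\mathbb R[X_1,\dots,X_n]$, where $V^*$ is the transpose of $V$. -/

import Mathlib

open scoped Kronecker

/-- A linear pencil `A₀ + X₁ A₁ + ⋯ + Xₙ Aₙ` of size `m` in `n` commuting variables, given by its
real symmetric coefficient matrices. -/
structure LinearPencil (n m : ℕ) where
  /-- the constant coefficient `A₀` -/
  const : Matrix (Fin m) (Fin m) ℝ
  /-- the coefficients `A₁, …, Aₙ` of the variables -/
  coeff : Fin n → Matrix (Fin m) (Fin m) ℝ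
  const_symm : const.IsSymm
  coeff_symm : ∀ i, (coeff i).IsSymm

namespace LinearPencil

variable {n m : ℕ}

/-- The pencil as a matrix with polynomial entries, `A₀ + ∑ Xᵢ Aᵢ`. -/
noncomputable def toPolyMatrix (L : LinearPencil n m) :
    Matrix (Fin m) (Fin m) (MvPolynomial (Fin n) ℝ) :=
  L.const.map MvPolynomial.C +
    ∑ i, (MvPolynomial.X i : MvPolynomial (Fin n) ℝ) • (L.coeff i).map MvPolynomial.C

/-- The evaluation `L(x) = A₀ + ∑ xᵢ Aᵢ` at a point `x` of `ℝⁿ`. -/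
def eval (L : LinearPencil n m) (x : Fin n → ℝ) : Matrix (Fin m) (Fin m) ℝ :=
  L.const + ∑ i, x i • L.coeff i

/-- The spectrahedron `S_L = {x ∈ ℝⁿ | L(x) ⪰ 0}`. -/
def spectrahedron (L : LinearPencil n m) : Set (Fin n → ℝ) :=
  {x | (L.eval x).PosSemidef}

/-- The evaluation `L(Z) = I_d ⊗ A₀ + ∑ Zᵢ ⊗ Aᵢ` at an `n`-tuple of `d × d` matrices. -/
def matEval (L : LinearPencil n m) {d : ℕ} (Z : Fin n → Matrix (Fin d) (Fin d) ℝ) :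
    Matrix (Fin d × Fin m) (Fin d × Fin m) ℝ :=
  (1 : Matrix (Fin d) (Fin d) ℝ) ⊗ₖ L.const + ∑ i, Z i ⊗ₖ L.coeff i

/-- The matricial spectrahedron: the (disjoint) union over `d ≥ 1` of the sets of `n`-tuples `Z` of
real symmetric `d × d` matrices with `L(Z) ⪰ 0`. -/
def matSpectrahedron (L : LinearPencil n m) :
    Set (Σ d : ℕ, (Fin n → Matrix (Fin d) (Fin d) ℝ)) :=
  {Z | 1 ≤ Z.1 ∧ (∀ i, (Z.2 i).IsSymm) ∧ (L.matEval Z.2).PosSemidef}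

/-- The operator system of `L`: the linear span of all coefficients `A₀, A₁, …, Aₙ`. -/
def operatorSystem (L : LinearPencil n m) : Submodule ℝ (Matrix (Fin m) (Fin m) ℝ) :=
  Submodule.span ℝ (insert L.const (Set.range L.coeff))

end LinearPencil

/-!
The tuples `(Vᵀ (1 ⊗ Aₒ) V)ₒ` form a convex cone, the image of the positive semidefinite cone under
the linear map `P ↦ (contraction Aₒ P)ₒ`. A positive definite combination of the `Aₒ` makes this map
injective at `0` on that cone, so the image is closed, and a tuple `Y` outside it is separated from
it by symmetric matrices `Bₒ` with `∑ Bₒ ⊗ Aₒ ⪰ 0` but not `∑ Bₒ ⊗ Yₒ ⪰ 0`.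

Inclusion of the matricial spectrahedra rules out such `B` when `B₀` is positive definite, because
a congruence normalizes `B₀` to `1`. Testing `∑ Bₒ ⊗ Aₒ ⪰ 0` on vectors `v ⊗ w` shows that always
`B₀ ⪰ 0`: otherwise, after adding a multiple of a positive definite value of the pencil, some
combination of `A₁, …, Aₙ` would be positive definite, hence a direction in which the spectrahedron
is unbounded. Adding `ε` times a scalar tuple to `B` then gives the general case as `ε → 0`.
-/

section

open Matrix Filter Topology

section ProperConeImage

variable {E F : Type*} [NormedAddCommGroup E] [NormedSpace ℝ E] [FiniteDimensional ℝ E]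
  [NormedAddCommGroup F] [NormedSpace ℝ F]

theorem exists_pos_mul_norm_le_of_mem_properCone {C : ProperCone ℝ E} {f : E →L[ℝ] F}
    (hf : ∀ x ∈ C, f x = 0 → x = 0) : ∃ δ > 0, ∀ x ∈ C, δ * ‖x‖ ≤ ‖f x‖ := by
  have hcompact : IsCompact (Metric.sphere 0 1 ∩ (C : Set E)) :=
    (isCompact_sphere 0 1).inter_right C.isClosed
  have hpos : ∀ u ∈ Metric.sphere 0 1 ∩ (C : Set E), 0 < ‖f u‖ := fun u hu ↦
    norm_pos_iff.2 fun h ↦ by simpa [hf u hu.2 h] using hu.1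
  obtain ⟨δ, hδ, hle⟩ := hcompact.exists_forall_le' f.continuous.norm.continuousOn hpos
  refine ⟨δ, hδ, fun x hx ↦ ?_⟩
  rcases eq_or_ne x 0 with rfl | hx0
  · simp
  · have hnorm : 0 < ‖x‖ := norm_pos_iff.2 hx0
    have := hle (‖x‖⁻¹ • x)
      ⟨by simp [norm_smul, hnorm.ne'], C.smul_mem hx (inv_nonneg.2 hnorm.le)⟩
    rwa [map_smul, norm_smul, norm_inv, norm_norm, inv_mul_eq_div, le_div_iff₀ hnorm] at this

theorem isClosed_image_properCone {C : ProperCone ℝ E} {f : E →L[ℝ] F}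
    (hf : ∀ x ∈ C, f x = 0 → x = 0) : IsClosed (f '' C) := by
  obtain ⟨δ, hδ, hle⟩ := exists_pos_mul_norm_le_of_mem_properCone hf
  refine IsSeqClosed.isClosed fun y z hy hyz ↦ ?_
  choose x hxC hxy using hy
  obtain rfl : (fun k ↦ f (x k)) = y := funext hxy
  obtain ⟨r, hr⟩ := (Metric.isBounded_range_of_tendsto _ hyz).exists_norm_le
  have hbdd : ∀ k, x k ∈ Metric.closedBall 0 (r / δ) := fun k ↦ by
    rw [mem_closedBall_zero_iff, le_div_iff₀' hδ]
    exact (hle _ (hxC k)).trans (hr _ ⟨k, rfl⟩)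
  obtain ⟨x₀, -, φ, hφ, hx₀⟩ := tendsto_subseq_of_bounded Metric.isBounded_closedBall hbdd
  exact ⟨x₀, C.isClosed.mem_of_tendsto hx₀ (.of_forall fun k ↦ hxC (φ k)),
    tendsto_nhds_unique ((f.continuous.tendsto x₀).comp hx₀) (hyz.comp hφ.tendsto_atTop)⟩

end ProperConeImage

theorem isClosed_setOf_posSemidef (n : Type*) :
    IsClosed {P : Matrix n n ℝ | P.PosSemidef} := by
  simp only [PosSemidef, IsHermitian, Set.ofPred_and, Set.ofPred_forall]
  refine (isClosed_eq (by fun_prop) continuous_id).inter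
    (isClosed_iInter fun v ↦ isClosed_le continuous_const ?_)
  refine continuous_finsetSum _ fun i _ ↦ continuous_finsetSum _ fun j _ ↦ ?_
  fun_prop

/-- The closed convex cone of positive semidefinite real matrices. -/
def posSemidefCone (n : Type*) : ProperCone ℝ (Matrix n n ℝ) where
  carrier := {P | P.PosSemidef}
  add_mem' := PosSemidef.add
  zero_mem' := PosSemidef.zero
  smul_mem' c _ hP := hP.smul c.2
  isClosed' := isClosed_setOf_posSemidef n

theorem exists_eq_sum_vecMulVec_vec {a b : Type*} [Finite a] [Finite b]
    {P : Matrix (b × a) (b × a) ℝ} (hP : P.PosSemidef) :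
    ∃ μ : ℕ, 1 ≤ μ ∧ ∃ V : Matrix (Fin μ × a) b ℝ,
      P = ∑ k, vecMulVec (vec (V.submatrix (Prod.mk k) id))
        (vec (V.submatrix (Prod.mk k) id)) := by
  cases nonempty_fintype a
  obtain ⟨m, v, hv⟩ := posSemidef_iff_eq_sum_vecMulVec.1 hP
  -- The zero summand only serves to make `μ` positive.
  let w : Fin (m + 1) → b × a → ℝ := Fin.cons 0 v
  refine ⟨m + 1, Nat.le_add_left 1 m, of fun z p ↦ w z.1 (p, z.2), ?_⟩
  change P = ∑ k, vecMulVec (w k) (w k)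
  simpa [w, Fin.sum_univ_succ] using hv

section Contraction

variable {R a b κ : Type*} [CommSemiring R] [Fintype a]

/-- The contraction of `P`, viewed as a `b × b` block matrix with blocks of size `a × a`, against
`A`: its `(p, q)` entry is the pairing `∑ x y, A x y * P (p, x) (q, y)`. On `P = vec V (vec V)ᵀ` it
is the compression `Vᵀ A V`, so it turns compressions into linear functions of `P`. -/
def contraction : Matrix a a R →ₗ[R] Matrix (b × a) (b × a) R →ₗ[R] Matrix b b R :=
  LinearMap.mk₂ R (fun A P ↦ of fun p q ↦ ∑ x, ∑ y, A x y * P (p, x) (q, y))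
    (fun A A' P ↦ by ext; simp [add_mul, Finset.sum_add_distrib])
    (fun c A P ↦ by ext; simp [mul_assoc, Finset.mul_sum])
    (fun A P P' ↦ by ext; simp [mul_add, Finset.sum_add_distrib])
    (fun c A P ↦ by ext; simp [mul_left_comm, Finset.mul_sum])

theorem contraction_vecMulVec_vec (A : Matrix a a R) (V : Matrix a b R) :
    contraction A (vecMulVec (vec V) (vec V)) = Vᵀ * A * V := by
  ext p q
  simp only [contraction, LinearMap.mk₂_apply, of_apply, vecMulVec_apply, vec, mul_apply,
    transpose_apply, Finset.sum_mul]
  rw [Finset.sum_comm]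
  exact Finset.sum_congr rfl fun y _ ↦ Finset.sum_congr rfl fun x _ ↦ by ring

theorem transpose_mul_one_kronecker_mul [Fintype κ] [DecidableEq κ] (A : Matrix a a R)
    (V : Matrix (κ × a) b R) :
    Vᵀ * ((1 : Matrix κ κ R) ⊗ₖ A) * V =
      ∑ k, (V.submatrix (Prod.mk k) id)ᵀ * A * V.submatrix (Prod.mk k) id := by
  ext p q
  simp [mul_apply, Matrix.sum_apply, Fintype.sum_prod_type, one_apply]

theorem contraction_sum_vecMulVec_vec [Fintype κ] [DecidableEq κ] (A : Matrix a a R)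
    (V : Matrix (κ × a) b R) :
    contraction A (∑ k, vecMulVec (vec (V.submatrix (Prod.mk k) id))
      (vec (V.submatrix (Prod.mk k) id))) = Vᵀ * ((1 : Matrix κ κ R) ⊗ₖ A) * V := by
  simp_rw [map_sum, contraction_vecMulVec_vec, transpose_mul_one_kronecker_mul]

theorem eq_zero_of_transpose_mul_mul_eq_zero {M : Matrix a a ℝ} (hM : M.PosDef)
    {V : Matrix a b ℝ} (h : Vᵀ * M * V = 0) : V = 0 := by
  ext x p
  by_contra hx
  have hpos := hM.dotProduct_mulVec_pos (x := V.col p) fun h0 ↦ hx (congrFun h0 x)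
  have hzero : V.col p ⬝ᵥ M *ᵥ V.col p = (Vᵀ * M * V) p p := by
    rw [dotProduct_mulVec]; rfl
  rw [star_trivial, hzero, h] at hpos
  exact hpos.false

theorem eq_zero_of_contraction_eq_zero [Finite b] {M : Matrix a a ℝ} (hM : M.PosDef)
    {P : Matrix (b × a) (b × a) ℝ} (hP : P.PosSemidef) (h : contraction M P = 0) : P = 0 := by
  classical
  obtain ⟨μ, -, V, rfl⟩ := exists_eq_sum_vecMulVec_vec hP
  rw [contraction_sum_vecMulVec_vec] at h
  have hV : V = 0 := eq_zero_of_transpose_mul_mul_eq_zero (PosDef.one.kronecker hM) h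
  simp [hV]

end Contraction

section Duality

variable {R ι a b : Type*} [CommSemiring R] [Fintype ι]

theorem isSymm_sum_kronecker {A : ι → Matrix a a R} {B : ι → Matrix b b R}
    (hA : ∀ i, (A i).IsSymm) (hB : ∀ i, (B i).IsSymm) : (∑ i, B i ⊗ₖ A i).IsSymm := by
  simp only [IsSymm, transpose_sum, ← kroneckerMap_transpose, (hA _).eq, (hB _).eq]

variable [Fintype a]

theorem isSymm_transpose_mul_mul {M : Matrix a a R} (hM : M.IsSymm) (V : Matrix a b R) :
    (Vᵀ * M * V).IsSymm := by
  rw [IsSymm, transpose_mul, transpose_mul, transpose_transpose, hM.eq, Matrix.mul_assoc]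

variable [Fintype b]

theorem exists_forall_apply_eq_trace_mul (f : Matrix b b R →ₗ[R] R) :
    ∃ B : Matrix b b R, ∀ Y, f Y = (B * Y).trace := by
  classical
  refine ⟨of fun p q ↦ f (single q p 1), fun Y ↦ ?_⟩
  have hsingle : ∀ p q, single p q (Y p q) = Y p q • single p q 1 := by simp [smul_single]
  calc f Y = ∑ p, ∑ q, Y p q * f (single p q 1) := by
        conv_lhs => rw [matrix_eq_sum_single Y]
        simp only [map_sum, hsingle, map_smul, smul_eq_mul]
    _ = (of (fun p q ↦ f (single q p 1)) * Y).trace := by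
        rw [Finset.sum_comm]
        simp only [trace, diag_apply, mul_apply, of_apply, mul_comm]

theorem exists_forall_apply_eq_sum_trace_mul (f : (ι → Matrix b b R) →ₗ[R] R) :
    ∃ B : ι → Matrix b b R, ∀ Y, f Y = ∑ i, (B i * Y i).trace := by
  classical
  choose B hB using fun i ↦ exists_forall_apply_eq_trace_mul
    (f ∘ₗ LinearMap.single R (fun _ ↦ Matrix b b R) i)
  refine ⟨B, fun Y ↦ ?_⟩
  conv_lhs => rw [← Finset.univ_sum_single Y, map_sum]
  exact Finset.sum_congr rfl fun i _ ↦ hB i (Y i)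

theorem trace_transpose_mul_of_isSymm (B : Matrix b b R) {Y : Matrix b b R} (hY : Y.IsSymm) :
    (Bᵀ * Y).trace = (B * Y).trace := by
  rw [← trace_transpose, transpose_mul, transpose_transpose, hY.eq, trace_mul_comm]

theorem vec_dotProduct_sum_add_transpose_kronecker_mulVec_vec {A : ι → Matrix a a R}
    (hA : ∀ i, (A i).IsSymm) (B : ι → Matrix b b R) (V : Matrix a b R) :
    vec V ⬝ᵥ (∑ i, (B i + (B i)ᵀ) ⊗ₖ A i) *ᵥ vec V =
      2 * ∑ i, (B i * (Vᵀ * A i * V)).trace := by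
  simp_rw [sum_mulVec, dotProduct_sum, kronecker_mulVec_vec, vec_dotProduct_vec, Finset.mul_sum]
  refine Finset.sum_congr rfl fun i _ ↦ ?_
  calc (Vᵀ * (A i * V * (B i + (B i)ᵀ)ᵀ)).trace = ((B i + (B i)ᵀ) * (Vᵀ * A i * V)).trace := by
        rw [(isSymm_add_transpose_self (B i)).eq, ← Matrix.mul_assoc, trace_mul_comm,
          ← Matrix.mul_assoc Vᵀ]
    _ = 2 * (B i * (Vᵀ * A i * V)).trace := by
        rw [Matrix.add_mul, trace_add,
          trace_transpose_mul_of_isSymm _ (isSymm_transpose_mul_mul (hA i) V), two_mul]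

open scoped Matrix.Norms.Elementwise in
theorem exists_sum_trace_mul_neg_of_not_exists_contraction_eq {A : ι → Matrix a a ℝ}
    {Y : ι → Matrix b b ℝ} {c : ι → ℝ} (hc : (∑ i, c i • A i).PosDef)
    (hY : ¬ ∃ P : Matrix (b × a) (b × a) ℝ, P.PosSemidef ∧ ∀ i, contraction (A i) P = Y i) :
    ∃ B : ι → Matrix b b ℝ,
      (∀ P : Matrix (b × a) (b × a) ℝ, P.PosSemidef →
        0 ≤ ∑ i, (B i * contraction (A i) P).trace) ∧
      ∑ i, (B i * Y i).trace < 0 := by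
  classical
  let f : Matrix (b × a) (b × a) ℝ →L[ℝ] (ι → Matrix b b ℝ) :=
    (LinearMap.pi fun i ↦ contraction (A i)).toContinuousLinearMap
  have hclosed : IsClosed (f '' posSemidefCone (b × a)) :=
    isClosed_image_properCone fun P hP hfP ↦ eq_zero_of_contraction_eq_zero hc hP <| by
      have hzero : ∀ i, contraction (A i) P = 0 := congrFun hfP
      simp [hzero]
  have hYf : Y ∉ (posSemidefCone (b × a)).map f := fun h ↦ by
    obtain ⟨P, hP, hPY⟩ := hclosed.closure_eq.subset (ProperCone.mem_map.1 h)
    exact hY ⟨P, hP, congrFun hPY⟩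
  have : LocallyConvexSpace ℝ (Matrix b b ℝ) :=
    inferInstanceAs (LocallyConvexSpace ℝ (b → b → ℝ))
  obtain ⟨g, hg, hgY⟩ := ProperCone.hyperplane_separation_point _ hYf
  obtain ⟨B, hB⟩ := exists_forall_apply_eq_sum_trace_mul g.toLinearMap
  refine ⟨B, fun P hP ↦ ?_, (hB Y).symm.trans_lt hgY⟩
  exact (hg (f P) (subset_closure ⟨P, hP, rfl⟩)).trans_eq (hB _)

end Duality

section Factorization

variable {ι a b : Type*} [Fintype ι] [Fintype a] [Finite b]

theorem exists_posSemidef_forall_contraction_eq {A : ι → Matrix a a ℝ} {Y : ι → Matrix b b ℝ}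
    {c : ι → ℝ} (hA : ∀ i, (A i).IsSymm) (hY : ∀ i, (Y i).IsSymm)
    (hc : (∑ i, c i • A i).PosDef)
    (hAY : ∀ B : ι → Matrix b b ℝ, (∀ i, (B i).IsSymm) → (∑ i, B i ⊗ₖ A i).PosSemidef →
      (∑ i, B i ⊗ₖ Y i).PosSemidef) :
    ∃ P : Matrix (b × a) (b × a) ℝ, P.PosSemidef ∧ ∀ i, contraction (A i) P = Y i := by
  classical
  cases nonempty_fintype b
  by_contra hne
  obtain ⟨B, hB, hBY⟩ := exists_sum_trace_mul_neg_of_not_exists_contraction_eq hc hne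
  have hBsymm : ∀ i, (B i + (B i)ᵀ).IsSymm := fun i ↦ isSymm_add_transpose_self (B i)
  have hpos : (∑ i, (B i + (B i)ᵀ) ⊗ₖ A i).PosSemidef := by
    refine .of_dotProduct_mulVec_nonneg ((conjTranspose_eq_transpose_of_trivial _).trans
      (isSymm_sum_kronecker hA hBsymm)) fun v ↦ ?_
    obtain ⟨V, rfl⟩ := (vec_bijective (m := a) (n := b) (R := ℝ)).surjective v
    rw [star_trivial, vec_dotProduct_sum_add_transpose_kronecker_mulVec_vec hA]
    simp only [← contraction_vecMulVec_vec]
    exact mul_nonneg zero_le_two (hB _ (posSemidef_vecMulVec_self_star _))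
  -- The second form takes the value `2 * ∑ i, trace (B i * Y i)` at the vectorized identity.
  have hnonneg := (hAY _ hBsymm hpos).dotProduct_mulVec_nonneg (vec 1)
  rw [star_trivial, vec_dotProduct_sum_add_transpose_kronecker_mulVec_vec hY] at hnonneg
  simp only [transpose_one, Matrix.one_mul, Matrix.mul_one] at hnonneg
  linarith

theorem exists_eq_transpose_mul_one_kronecker_mul {A : ι → Matrix a a ℝ} {Y : ι → Matrix b b ℝ}
    {c : ι → ℝ} (hA : ∀ i, (A i).IsSymm) (hY : ∀ i, (Y i).IsSymm)
    (hc : (∑ i, c i • A i).PosDef)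
    (hAY : ∀ B : ι → Matrix b b ℝ, (∀ i, (B i).IsSymm) → (∑ i, B i ⊗ₖ A i).PosSemidef →
      (∑ i, B i ⊗ₖ Y i).PosSemidef) :
    ∃ μ : ℕ, 1 ≤ μ ∧ ∃ V : Matrix (Fin μ × a) b ℝ,
      ∀ i, Y i = Vᵀ * ((1 : Matrix (Fin μ) (Fin μ) ℝ) ⊗ₖ A i) * V := by
  obtain ⟨P, hP, hPY⟩ := exists_posSemidef_forall_contraction_eq hA hY hc hAY
  obtain ⟨μ, hμ, V, rfl⟩ := exists_eq_sum_vecMulVec_vec hP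
  exact ⟨μ, hμ, V, fun i ↦ by rw [← hPY, contraction_sum_vecMulVec_vec]⟩

end Factorization

section Congruence

open scoped MatrixOrder Matrix.Norms.L2Operator in
theorem exists_isUnit_transpose_mul_mul_eq_one {a : Type*} [Fintype a] [DecidableEq a]
    {M : Matrix a a ℝ} (hM : M.PosDef) : ∃ T : Matrix a a ℝ, IsUnit T ∧ Tᵀ * M * T = 1 := by
  obtain ⟨_, ⟨u, rfl⟩, rfl⟩ := CStarAlgebra.isStrictlyPositive_iff_eq_star_mul_self.1
    hM.isStrictlyPositive
  refine ⟨↑u⁻¹, u⁻¹.isUnit, ?_⟩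
  rw [star_eq_conjTranspose, conjTranspose_eq_transpose_of_trivial, ← Matrix.mul_assoc,
    ← transpose_mul, u.mul_inv, transpose_one, Matrix.one_mul, u.mul_inv]

theorem posSemidef_transpose_mul_mul_same {a b : Type*} [Fintype a] [Finite b] {M : Matrix a a ℝ}
    (hM : M.PosSemidef) (V : Matrix a b ℝ) : (Vᵀ * M * V).PosSemidef := by
  simpa using hM.conjTranspose_mul_mul_same V

theorem kronecker_sum_right {R ι a b c d : Type*} [NonUnitalNonAssocSemiring R]
    (B : Matrix c d R) (s : Finset ι) (A : ι → Matrix a b R) :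
    B ⊗ₖ ∑ i ∈ s, A i = ∑ i ∈ s, B ⊗ₖ A i := by
  ext
  simp [Matrix.sum_apply, Finset.mul_sum]

theorem forall_sum_option_elim_smul_eq_iff {R ι E : Type*} [Semiring R] [Fintype ι]
    [AddCommGroup E] [Module R E] {M N : Option ι → E} :
    (∀ x : ι → R, ∑ o, o.elim 1 x • M o = ∑ o, o.elim 1 x • N o) ↔ ∀ o, M o = N o := by
  classical
  refine ⟨fun h ↦ ?_, fun h x ↦ by simp only [h]⟩
  have hnone : M none = N none := by simpa [Fintype.sum_option] using h 0
  rintro (_ | i)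
  · exact hnone
  · simpa [Fintype.sum_option, hnone, Pi.single_apply, ite_smul] using h (Pi.single i 1)

end Congruence

namespace LinearPencil

variable {n m m₁ m₂ : ℕ} {L₁ : LinearPencil n m₁} {L₂ : LinearPencil n m₂}

/-- The coefficients of the homogenization `X₀ A₀ + X₁ A₁ + ⋯ + Xₙ Aₙ` of the pencil; the
homogenizing variable `X₀` has index `none`. -/
def homCoeff (L : LinearPencil n m) (o : Option (Fin n)) : Matrix (Fin m) (Fin m) ℝ :=
  o.elim L.const L.coeff

theorem homCoeff_isSymm (L : LinearPencil n m) (o : Option (Fin n)) : (L.homCoeff o).IsSymm := by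
  cases o with
  | none => exact L.const_symm
  | some i => exact L.coeff_symm i

theorem eval_eq_sum_homCoeff (L : LinearPencil n m) (x : Fin n → ℝ) :
    L.eval x = ∑ o, o.elim 1 x • L.homCoeff o := by
  simp [eval, Fintype.sum_option, homCoeff]

theorem map_eval_toPolyMatrix (L : LinearPencil n m) (x : Fin n → ℝ) :
    L.toPolyMatrix.map (MvPolynomial.eval x) = L.eval x := by
  ext p q
  simp [toPolyMatrix, eval, Matrix.sum_apply]

theorem toPolyMatrix_eq_iff_forall_eval_eq {κ : Type*} [Fintype κ] [DecidableEq κ]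
    {V : Matrix (κ × Fin m₁) (Fin m₂) ℝ} :
    L₂.toPolyMatrix =
        (Vᵀ.map MvPolynomial.C : Matrix (Fin m₂) (κ × Fin m₁) (MvPolynomial (Fin n) ℝ)) *
          ((1 : Matrix κ κ (MvPolynomial (Fin n) ℝ)) ⊗ₖ L₁.toPolyMatrix) *
          (V.map MvPolynomial.C : Matrix (κ × Fin m₁) (Fin m₂) (MvPolynomial (Fin n) ℝ)) ↔
      ∀ x, L₂.eval x = Vᵀ * ((1 : Matrix κ κ ℝ) ⊗ₖ L₁.eval x) * V := by
  have hmap : ∀ x : Fin n → ℝ,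
      ((Vᵀ.map MvPolynomial.C : Matrix (Fin m₂) (κ × Fin m₁) (MvPolynomial (Fin n) ℝ)) *
        ((1 : Matrix κ κ (MvPolynomial (Fin n) ℝ)) ⊗ₖ L₁.toPolyMatrix) *
        (V.map MvPolynomial.C : Matrix (κ × Fin m₁) (Fin m₂) (MvPolynomial (Fin n) ℝ))).map
          (MvPolynomial.eval x) =
        Vᵀ * ((1 : Matrix κ κ ℝ) ⊗ₖ L₁.eval x) * V := fun x ↦ by
    rw [Matrix.map_mul, Matrix.map_mul, ← map_eval_toPolyMatrix]
    congr 2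
    · ext; simp
    · ext z w
      by_cases hzw : z.1 = w.1 <;> simp [one_apply, hzw]
    · ext; simp
  constructor
  · intro h x
    rw [← hmap, ← h, map_eval_toPolyMatrix]
  · intro h
    refine Matrix.ext fun p q ↦ MvPolynomial.funext fun x ↦ ?_
    have hx := (map_eval_toPolyMatrix L₂ x).trans ((h x).trans (hmap x).symm)
    exact congrFun₂ hx p q

theorem forall_eval_eq_iff_forall_homCoeff_eq {κ : Type*} [Fintype κ] [DecidableEq κ]
    {V : Matrix (κ × Fin m₁) (Fin m₂) ℝ} :
    (∀ x, L₂.eval x = Vᵀ * ((1 : Matrix κ κ ℝ) ⊗ₖ L₁.eval x) * V) ↔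
      ∀ o, L₂.homCoeff o = Vᵀ * ((1 : Matrix κ κ ℝ) ⊗ₖ L₁.homCoeff o) * V := by
  rw [← forall_sum_option_elim_smul_eq_iff (R := ℝ)]
  simp only [eval_eq_sum_homCoeff, kronecker_sum_right, kronecker_smul, Matrix.mul_sum,
    Matrix.sum_mul, Matrix.mul_smul, Matrix.smul_mul]

/-- The value `∑ₒ Bₒ ⊗ Aₒ` of the homogenization of the pencil at a tuple of square matrices. -/
def homEval {d : Type*} (L : LinearPencil n m) (B : Option (Fin n) → Matrix d d ℝ) :
    Matrix (d × Fin m) (d × Fin m) ℝ :=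
  ∑ o, B o ⊗ₖ L.homCoeff o

theorem matEval_eq_homEval (L : LinearPencil n m) {d : ℕ} (Z : Fin n → Matrix (Fin d) (Fin d) ℝ) :
    L.matEval Z = L.homEval fun o ↦ o.elim 1 Z := by
  simp [homEval, matEval, Fintype.sum_option, homCoeff]

section HomEval

variable {d e : Type*}

theorem homEval_add_smul (L : LinearPencil n m) (B E : Option (Fin n) → Matrix d d ℝ) (ε : ℝ) :
    L.homEval (fun o ↦ B o + ε • E o) = L.homEval B + ε • L.homEval E := by
  simp only [homEval, add_kronecker, smul_kronecker, Finset.sum_add_distrib, Finset.smul_sum]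

theorem homEval_smul_one [DecidableEq d] (L : LinearPencil n m) (x : Fin n → ℝ) :
    L.homEval (fun o ↦ o.elim (1 : ℝ) x • (1 : Matrix d d ℝ)) = 1 ⊗ₖ L.eval x := by
  simp only [homEval, eval_eq_sum_homCoeff, kronecker_sum_right, kronecker_smul, smul_kronecker]

variable [Fintype d]

theorem homEval_transpose_mul_mul (L : LinearPencil n m) (B : Option (Fin n) → Matrix d d ℝ)
    (S : Matrix d e ℝ) :
    L.homEval (fun o ↦ Sᵀ * B o * S) =
      (S ⊗ₖ (1 : Matrix (Fin m) (Fin m) ℝ))ᵀ * L.homEval B *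
        (S ⊗ₖ (1 : Matrix (Fin m) (Fin m) ℝ)) := by
  simp only [homEval, Matrix.mul_sum, Matrix.sum_mul, ← kroneckerMap_transpose,
    ← mul_kronecker_mul, transpose_one, Matrix.one_mul, Matrix.mul_one]

theorem homEval_transpose_mul_mul_posSemidef_iff [DecidableEq d] (L : LinearPencil n m)
    (B : Option (Fin n) → Matrix d d ℝ) {T : Matrix d d ℝ} (hT : IsUnit T) :
    (L.homEval fun o ↦ Tᵀ * B o * T).PosSemidef ↔ (L.homEval B).PosSemidef := by
  rw [homEval_transpose_mul_mul, ← conjTranspose_eq_transpose_of_trivial, ← star_eq_conjTranspose]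
  exact (hT.kronecker isUnit_one).posSemidef_star_left_conjugate_iff

theorem sum_dotProduct_mulVec_smul_homCoeff_posSemidef {L : LinearPencil n m}
    {B : Option (Fin n) → Matrix d d ℝ} (hB : (L.homEval B).PosSemidef) (v : d → ℝ) :
    (∑ o, (v ⬝ᵥ B o *ᵥ v) • L.homCoeff o).PosSemidef := by
  have hcongr := posSemidef_transpose_mul_mul_same hB
    (replicateCol Unit v ⊗ₖ (1 : Matrix (Fin m) (Fin m) ℝ))
  rw [← homEval_transpose_mul_mul] at hcongr
  have hentry : ∀ o, ((replicateCol Unit v)ᵀ * B o * replicateCol Unit v) () () =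
      v ⬝ᵥ B o *ᵥ v := fun o ↦ by
    rw [dotProduct_mulVec]
    rfl
  convert hcongr.submatrix (Prod.mk ()) using 1
  ext p q
  simp [homEval, Matrix.sum_apply, hentry, -transpose_replicateCol]

end HomEval

theorem homEval_posSemidef_of_homCoeff_eq {d κ : Type*} [Finite d] [Fintype κ] [DecidableEq κ]
    {V : Matrix (κ × Fin m₁) (Fin m₂) ℝ}
    (h : ∀ o, L₂.homCoeff o = Vᵀ * ((1 : Matrix κ κ ℝ) ⊗ₖ L₁.homCoeff o) * V)
    {B : Option (Fin n) → Matrix d d ℝ} (hB : (L₁.homEval B).PosSemidef) :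
    (L₂.homEval B).PosSemidef := by
  classical
  cases nonempty_fintype d
  let W (k : κ) : Matrix (d × Fin m₁) (d × Fin m₂) ℝ :=
    (1 : Matrix d d ℝ) ⊗ₖ V.submatrix (Prod.mk k) id
  have hsum : L₂.homEval B = ∑ k, (W k)ᵀ * L₁.homEval B * W k := by
    simp only [W, homEval, h, transpose_mul_one_kronecker_mul, kronecker_sum_right, Matrix.mul_sum,
      Matrix.sum_mul, ← kroneckerMap_transpose, ← mul_kronecker_mul, transpose_one, Matrix.one_mul,
      Matrix.mul_one]
    exact Finset.sum_comm
  rw [hsum]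
  exact posSemidef_sum _ fun k _ ↦ posSemidef_transpose_mul_mul_same hB (W k)

theorem not_posDef_sum_smul_coeff_of_isBounded (hm : 1 ≤ m) {L : LinearPencil n m}
    (hne : L.spectrahedron.Nonempty) (hbdd : Bornology.IsBounded L.spectrahedron) (y : Fin n → ℝ) :
    ¬ (∑ i, y i • L.coeff i).PosDef := by
  intro hy
  obtain ⟨x, hx⟩ := hne
  obtain ⟨R, hR⟩ := hbdd.exists_norm_le
  have hy0 : 0 < ‖y‖ := norm_pos_iff.2 fun h ↦ by
    simpa [h] using hy.diag_pos (i := ⟨0, hm⟩)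
  have hray : ∀ t : ℝ, 0 ≤ t → x + t • y ∈ L.spectrahedron := fun t ht ↦ by
    have heval : L.eval (x + t • y) = L.eval x + t • ∑ i, y i • L.coeff i := by
      simp [eval, add_smul, Finset.sum_add_distrib, Finset.smul_sum, smul_smul, add_assoc]
    rw [spectrahedron, Set.mem_ofPred, heval]
    exact hx.add (hy.posSemidef.smul ht)
  have hbound : ∀ t : ℝ, 0 ≤ t → t * ‖y‖ ≤ R + ‖x‖ := fun t ht ↦
    calc t * ‖y‖ = ‖(x + t • y) - x‖ := by
          rw [add_sub_cancel_left, norm_smul, Real.norm_of_nonneg ht]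
      _ ≤ ‖x + t • y‖ + ‖x‖ := norm_sub_le _ _
      _ ≤ R + ‖x‖ := by gcongr; exact hR _ (hray t ht)
  have hle := hbound ((|R + ‖x‖| + 1) / ‖y‖) (by positivity)
  rw [div_mul_cancel₀ _ hy0.ne'] at hle
  linarith [le_abs_self (R + ‖x‖)]

theorem exists_eval_posDef {L : LinearPencil n m} (hne : L.spectrahedron.Nonempty)
    (hpd : ∃ A ∈ L.operatorSystem, A.PosDef)
    (hdir : ∀ y : Fin n → ℝ, ¬ (∑ i, y i • L.coeff i).PosDef) : ∃ x, (L.eval x).PosDef := by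
  obtain ⟨A, hA, hApd⟩ := hpd
  obtain ⟨s, B, hB, rfl⟩ := Submodule.mem_span_insert.1 hA
  obtain ⟨c, rfl⟩ := (Submodule.mem_span_range_iff_exists_fun ℝ).1 hB
  rcases lt_or_ge 0 s with hs | hs
  · refine ⟨s⁻¹ • c, ?_⟩
    have heval : L.eval (s⁻¹ • c) = s⁻¹ • (s • L.const + ∑ i, c i • L.coeff i) := by
      simp [eval, Finset.smul_sum, smul_smul, hs.ne']
    rw [heval]
    exact hApd.smul (inv_pos.2 hs)
  · obtain ⟨x, hx⟩ := hne
    have hsum : ∑ i, (c i - s * x i) • L.coeff i =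
        (s • L.const + ∑ i, c i • L.coeff i) + (-s) • L.eval x := by
      simp only [eval, sub_smul, mul_smul, Finset.sum_sub_distrib, ← Finset.smul_sum]
      module
    refine (hdir (fun i ↦ c i - s * x i) ?_).elim
    rw [hsum]
    exact hApd.add_posSemidef (PosSemidef.smul hx (neg_nonneg.2 hs))

theorem nonneg_of_sum_smul_homCoeff_posSemidef {L : LinearPencil n m} {x : Fin n → ℝ}
    (hx : (L.eval x).PosDef) (hdir : ∀ y : Fin n → ℝ, ¬ (∑ i, y i • L.coeff i).PosDef)
    {b : Option (Fin n) → ℝ} (hb : (∑ o, b o • L.homCoeff o).PosSemidef) : 0 ≤ b none := by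
  by_contra! hneg
  have hsum : ∑ i, (b (some i) - b none * x i) • L.coeff i =
      (-b none) • L.eval x + ∑ o, b o • L.homCoeff o := by
    simp only [eval, sub_smul, mul_smul, Finset.sum_sub_distrib, ← Finset.smul_sum,
      Fintype.sum_option, homCoeff, Option.elim]
    module
  refine hdir (fun i ↦ b (some i) - b none * x i) ?_
  rw [hsum]
  exact (hx.smul (neg_pos.2 hneg)).add_posSemidef hb

theorem posSemidef_none_of_homEval_posSemidef {d : Type*} [Finite d] {L : LinearPencil n m}
    {B : Option (Fin n) → Matrix d d ℝ} {x : Fin n → ℝ} (hx : (L.eval x).PosDef)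
    (hdir : ∀ y : Fin n → ℝ, ¬ (∑ i, y i • L.coeff i).PosDef) (hB : (B none).IsSymm)
    (hpos : (L.homEval B).PosSemidef) : (B none).PosSemidef := by
  cases nonempty_fintype d
  exact .of_dotProduct_mulVec_nonneg ((conjTranspose_eq_transpose_of_trivial _).trans hB) fun v ↦
    nonneg_of_sum_smul_homCoeff_posSemidef hx hdir
      (sum_dotProduct_mulVec_smul_homCoeff_posSemidef hpos v)

section Inclusion

variable {d : ℕ} {B : Option (Fin n) → Matrix (Fin d) (Fin d) ℝ}

theorem homEval_posSemidef_of_posDef_none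
    (hsub : L₁.matSpectrahedron ⊆ L₂.matSpectrahedron) (hB : ∀ o, (B o).IsSymm)
    (hnone : (B none).PosDef) (hpos : (L₁.homEval B).PosSemidef) :
    (L₂.homEval B).PosSemidef := by
  rcases d.eq_zero_or_pos with rfl | hd
  · rw [Subsingleton.elim (L₂.homEval B) 0]
    exact .zero
  obtain ⟨T, hT, hT1⟩ := exists_isUnit_transpose_mul_mul_eq_one hnone
  let Z : Fin n → Matrix (Fin d) (Fin d) ℝ := fun i ↦ Tᵀ * B (some i) * T
  have hZ : (fun o ↦ Tᵀ * B o * T) = fun o ↦ o.elim 1 Z := by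
    funext o
    cases o with
    | none => exact hT1
    | some i => rfl
  have hmem : (⟨d, Z⟩ : Σ d : ℕ, (Fin n → Matrix (Fin d) (Fin d) ℝ)) ∈ L₁.matSpectrahedron := by
    refine ⟨hd, fun i ↦ isSymm_transpose_mul_mul (hB _) T, ?_⟩
    rw [matEval_eq_homEval, ← hZ]
    exact (L₁.homEval_transpose_mul_mul_posSemidef_iff B hT).2 hpos
  rw [← L₂.homEval_transpose_mul_mul_posSemidef_iff B hT, hZ, ← matEval_eq_homEval]
  exact (hsub hmem).2.2

theorem homEval_posSemidef_of_matSpectrahedron_subset {x : Fin n → ℝ} (hx : (L₁.eval x).PosDef)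
    (hdir : ∀ y : Fin n → ℝ, ¬ (∑ i, y i • L₁.coeff i).PosDef)
    (hsub : L₁.matSpectrahedron ⊆ L₂.matSpectrahedron) (hB : ∀ o, (B o).IsSymm)
    (hpos : (L₁.homEval B).PosSemidef) : (L₂.homEval B).PosSemidef := by
  have hnone := posSemidef_none_of_homEval_posSemidef hx hdir (hB none) hpos
  let E : Option (Fin n) → Matrix (Fin d) (Fin d) ℝ := fun o ↦ o.elim (1 : ℝ) x • 1
  have hE : (L₁.homEval E).PosSemidef := by
    rw [homEval_smul_one]
    exact PosSemidef.one.kronecker hx.posSemidef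
  have hpert : ∀ ε : ℝ, 0 < ε → (L₂.homEval B + ε • L₂.homEval E).PosSemidef := fun ε hε ↦ by
    rw [← homEval_add_smul]
    refine homEval_posSemidef_of_posDef_none hsub
      (fun o ↦ (hB o).add ((isSymm_one.smul _).smul ε)) ?_ ?_
    · simpa [E] using PosDef.posSemidef_add hnone (PosDef.one.smul hε)
    · rw [homEval_add_smul]
      exact hpos.add (hE.smul hε.le)
  have hlim : Tendsto (fun ε : ℝ ↦ L₂.homEval B + ε • L₂.homEval E) (𝓝[>] 0)
      (𝓝 (L₂.homEval B)) :=
    (Continuous.tendsto' (by fun_prop) 0 _ (by simp)).mono_left nhdsWithin_le_nhds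
  exact (isClosed_setOf_posSemidef _).mem_of_tendsto hlim
    (eventually_nhdsWithin_of_forall hpert)

end Inclusion

theorem matSpectrahedron_subset_of_homCoeff_eq {κ : Type*} [Fintype κ] [DecidableEq κ]
    {V : Matrix (κ × Fin m₁) (Fin m₂) ℝ}
    (h : ∀ o, L₂.homCoeff o = Vᵀ * ((1 : Matrix κ κ ℝ) ⊗ₖ L₁.homCoeff o) * V) :
    L₁.matSpectrahedron ⊆ L₂.matSpectrahedron := fun Z ⟨hd, hsymm, hpos⟩ ↦
  ⟨hd, hsymm, by
    rw [matEval_eq_homEval] at hpos ⊢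
    exact homEval_posSemidef_of_homCoeff_eq h hpos⟩

end LinearPencil

end

theorem mainTheorem12_general {n m₁ m₂ : ℕ} (L₁ : LinearPencil n m₁) (L₂ : LinearPencil n m₂)
    (hne : L₁.spectrahedron.Nonempty)
    (hpd : ∃ A ∈ L₁.operatorSystem, A.PosDef)
    (hdir : ∀ y : Fin n → ℝ, ¬ (∑ i, y i • L₁.coeff i).PosDef) :
    L₁.matSpectrahedron ⊆ L₂.matSpectrahedron ↔
      ∃ μ : ℕ, 1 ≤ μ ∧ ∃ V : Matrix (Fin μ × Fin m₁) (Fin m₂) ℝ,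
        L₂.toPolyMatrix =
          (V.transpose.map MvPolynomial.C :
              Matrix (Fin m₂) (Fin μ × Fin m₁) (MvPolynomial (Fin n) ℝ)) *
            ((1 : Matrix (Fin μ) (Fin μ) (MvPolynomial (Fin n) ℝ)) ⊗ₖ L₁.toPolyMatrix) *
            (V.map MvPolynomial.C :
              Matrix (Fin μ × Fin m₁) (Fin m₂) (MvPolynomial (Fin n) ℝ)) := by
  simp only [LinearPencil.toPolyMatrix_eq_iff_forall_eval_eq,
    LinearPencil.forall_eval_eq_iff_forall_homCoeff_eq]
  constructor
  · intro hsub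
    obtain ⟨x, hx⟩ := LinearPencil.exists_eval_posDef hne hpd hdir
    refine exists_eq_transpose_mul_one_kronecker_mul L₁.homCoeff_isSymm L₂.homCoeff_isSymm
      (c := fun o ↦ o.elim 1 x) (by rwa [← LinearPencil.eval_eq_sum_homCoeff]) fun B hB hpos ↦ ?_
    exact LinearPencil.homEval_posSemidef_of_matSpectrahedron_subset hx hdir hsub hB hpos
  · rintro ⟨μ, -, V, hV⟩
    exact LinearPencil.matSpectrahedron_subset_of_homCoeff_eq hV

theorem mainTheorem12 {n m₁ m₂ : ℕ} (hm₁ : 1 ≤ m₁)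
    (L₁ : LinearPencil n m₁) (L₂ : LinearPencil n m₂)
    (hne : L₁.spectrahedron.Nonempty)
    (hbdd : Bornology.IsBounded L₁.spectrahedron)
    (hpd : ∃ A ∈ L₁.operatorSystem, A.PosDef) :
    L₁.matSpectrahedron ⊆ L₂.matSpectrahedron ↔
      ∃ μ : ℕ, 1 ≤ μ ∧ ∃ V : Matrix (Fin μ × Fin m₁) (Fin m₂) ℝ,
        L₂.toPolyMatrix =
          (V.transpose.map MvPolynomial.C :
              Matrix (Fin m₂) (Fin μ × Fin m₁) (MvPolynomial (Fin n) ℝ)) *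
            ((1 : Matrix (Fin μ) (Fin μ) (MvPolynomial (Fin n) ℝ)) ⊗ₖ L₁.toPolyMatrix) *
            (V.map MvPolynomial.C :
              Matrix (Fin μ × Fin m₁) (Fin m₂) (MvPolynomial (Fin n) ℝ)) :=
  mainTheorem12_general L₁ L₂ hne hpd
    (LinearPencil.not_posDef_sum_smul_coeff_of_isBounded hm₁ hne hbdd)
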